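/- All graphs are finite and simple. A weight function on a graph $G=(V,E)$ is a function $w:E\to[0,\infty)$; write $w(G)=\sum_{e\in E}w(e)$, and let $\Delta(G)$ denote the maximum degree of $G$. A bisection of $G$ is the set of edges of $G$ between $A$ and $V\setminus A$ for some $A\subseteq V$ such that $A$ and $V\setminus A$ are non-empty and $\bigl||A|-|V\setminus A|\bigr|\le 1$; its weight is the sum of the weights of its edges. Theorem. For almost all graphs $G=(V,E)$ the following holds for every weight function $w$ on $E$ and every positive integer $k$ with $\Delta(G)\le k$: if $k$ is odd, then $G$ has a bisection of weight at least $\frac{k+1}{2k}\,w(G)$, and if $k$ is even, then $G$ has a bisection of weight at least $\frac{k+2}{2(k+1)}\,w(G)$. Here "almost all graphs" means that, among the $2^{\binom n2}$ labelled graphs with vertex set $\{1,\dots,n\}$, the proportion of those with the stated property tends to $1$ as $n\to\infty$. -/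

import Mathlib

open Filter Topology

namespace WeightedBisection

/-- The edges of `G` between `A` and its complement. -/
def cutEdges {V : Type*} (G : SimpleGraph V) (A : Finset V) : Set G.edgeSet :=
  {e | ∃ a ∈ A, ∃ b, b ∉ A ∧ (e : Sym2 V) = s(a, b)}

open Classical in
/-- `w(G)`: the total weight of the edges of `G`. -/
noncomputable def totalWeight {V : Type*} [Fintype V] (G : SimpleGraph V)
    (w : G.edgeSet → ℝ) : ℝ :=
  ∑ e : G.edgeSet, w e

open Classical in
/-- The weight of the cut of `G` with parts `A` and its complement. -/
noncomputable def cutWeight {V : Type*} [Fintype V] (G : SimpleGraph V)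
    (w : G.edgeSet → ℝ) (A : Finset V) : ℝ :=
  ∑ e : G.edgeSet with e ∈ cutEdges G A, w e

open Classical in
/-- `A` and its complement are the parts of a bisection: both parts are non-empty and their
sizes differ by at most one. -/
def IsBisection {V : Type*} [Fintype V] (A : Finset V) : Prop :=
  A.Nonempty ∧ A ≠ Finset.univ ∧ |(A.card : ℤ) - (Aᶜ.card : ℤ)| ≤ 1

/-- The weighted graph `(G, w)` has a bisection of weight at least `c`. -/
def HasBisectionOfWeightAtLeast {V : Type*} [Fintype V] (G : SimpleGraph V)
    (w : G.edgeSet → ℝ) (c : ℝ) : Prop :=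
  ∃ A : Finset V, IsBisection A ∧ c ≤ cutWeight G w A

open Classical in
/-- The conjectured bound for the weighted graph `(G, w)`, for every positive integer `k` that
bounds the maximum degree of `G`. -/
def SatisfiesBisectionBound {V : Type*} [Fintype V] (G : SimpleGraph V)
    (w : G.edgeSet → ℝ) : Prop :=
  ∀ k : ℕ, 0 < k → G.maxDegree ≤ k →
    (Odd k → HasBisectionOfWeightAtLeast G w
      (((k : ℝ) + 1) / (2 * (k : ℝ)) * totalWeight G w)) ∧
    (Even k → HasBisectionOfWeightAtLeast G w
      (((k : ℝ) + 2) / (2 * ((k : ℝ) + 1)) * totalWeight G w))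

/-- Almost all graphs have the property `P`: the proportion of the (labelled, simple) graphs on
`n` vertices that have it tends to `1` as `n` tends to infinity. -/
def AlmostAllGraphs (P : ∀ n : ℕ, SimpleGraph (Fin n) → Prop) : Prop :=
  Tendsto (fun n : ℕ =>
    (Nat.card {G : SimpleGraph (Fin n) // P n G} : ℝ) / (Nat.card (SimpleGraph (Fin n)) : ℝ))
    atTop (𝓝 1)

end WeightedBisection

namespace WeightedBisection

/-! Put t = ⌊n/2⌋. Almost every graph has t disjoint non-adjacent pairs of vertices
(`tendsto_failRatio_hasNonEdgeMatching`) and maximum degree at least n/2 + 2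
(`tendsto_failRatio_hasLargeMaxDegree`), so k ≥ t + 2. The rest is deterministic. Place each pair on
one side, except for at most one pair that parity forces to be split, and permute the signs of the
pairs at random. No edge lies inside a pair, and the balance of the signs makes two vertices from
different pairs negatively correlated, with mean product at most -1/(t+2) (`sum_spin_mul_spin_le`).
Each edge is therefore cut with probability at least 1/2 + 1/(2(t+2)), and some bisection reaches
this proportion of w(G) (`hasBisection_of_pairing`). Since k ≥ t + 2, this is at least 1/2 + 1/(2k),
the odd bound, and a fortiori 1/2 + 1/(2(k+1)), the even one. The two properties of G do not involve
w, so all weights are handled at once. -/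

/-! ### Counting labelled graphs -/

/-- Prescribing the trace of a graph on a set of potential edges `e i` has the expected
proportion. -/
theorem card_graph_trace_mul_le {V ι : Type*} [Fintype V] [Fintype ι] (e : ι → Sym2 V)
    (he : Function.Injective e) (hd : ∀ i, ¬ (e i).IsDiag) (Q : Set (Set ι)) :
    Nat.card {G : SimpleGraph V // {i | e i ∈ G.edgeSet} ∈ Q} * 2 ^ Fintype.card ι ≤
      Nat.card Q * Nat.card (SimpleGraph V) := by
  classical
  have h2 : 2 ^ Fintype.card ι = Nat.card (Set ι) := by simp
  rw [h2, ← Nat.card_prod, ← Nat.card_prod]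
  -- Send (G, T) to the trace of G together with G after its trace is overwritten by T. T is read
  -- off from the new graph, and G from its old trace and its unchanged edges.
  refine Nat.card_le_card_of_injective
    (fun p : {G : SimpleGraph V // {i | e i ∈ G.edgeSet} ∈ Q} × Set ι =>
      ((⟨_, p.1.2⟩, SimpleGraph.fromEdgeSet ((p.1.1.edgeSet \ Set.range e) ∪ e '' p.2)) :
        Q × SimpleGraph V)) ?_
  rintro ⟨⟨G, hG⟩, T⟩ ⟨⟨G', hG'⟩, T'⟩ h
  simp only [Prod.mk.injEq, Subtype.mk.injEq] at h
  obtain ⟨h₁, h₂⟩ := h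
  have h₃ : ∀ x : Sym2 V, ¬ x.IsDiag →
      (((x ∈ G.edgeSet ∧ x ∉ Set.range e) ∨ x ∈ e '' T) ↔
        ((x ∈ G'.edgeSet ∧ x ∉ Set.range e) ∨ x ∈ e '' T')) := by
    intro x hx
    have := congrArg (fun H : SimpleGraph V => x ∈ H.edgeSet) h₂
    simpa [SimpleGraph.edgeSet_fromEdgeSet, hx] using this
  have hT : T = T' := by
    ext i
    have := h₃ (e i) (hd i)
    simpa [he.mem_set_image] using this
  have hGG : G = G' := by
    rw [← SimpleGraph.edgeSet_inj]
    ext x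
    by_cases hx : x.IsDiag
    · exact ⟨fun h => absurd hx (G.not_isDiag_of_mem_edgeSet h),
        fun h => absurd hx (G'.not_isDiag_of_mem_edgeSet h)⟩
    by_cases hr : x ∈ Set.range e
    · obtain ⟨i, rfl⟩ := hr
      exact Set.ext_iff.1 h₁ i
    · have hi : ∀ S : Set ι, x ∉ e '' S := fun S hS => hr (Set.image_subset_range _ _ hS)
      simpa [hr, hi] using h₃ x hx
  subst hT hGG
  rfl

/-- The proportion of the graphs on `n` vertices without the property `P`. -/
noncomputable def failRatio (P : ∀ n : ℕ, SimpleGraph (Fin n) → Prop) (n : ℕ) : ℝ :=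
  (Nat.card {G : SimpleGraph (Fin n) // ¬ P n G} : ℝ) / (Nat.card (SimpleGraph (Fin n)) : ℝ)

theorem card_graph_pos (n : ℕ) : (0 : ℝ) < Nat.card (SimpleGraph (Fin n)) :=
  Nat.cast_pos.2 Nat.card_pos

theorem failRatio_nonneg (P : ∀ n : ℕ, SimpleGraph (Fin n) → Prop) (n : ℕ) :
    0 ≤ failRatio P n := by
  unfold failRatio
  positivity

theorem almostAllGraphs_of_failRatio {P : ∀ n : ℕ, SimpleGraph (Fin n) → Prop}
    (h : Tendsto (failRatio P) atTop (𝓝 0)) : AlmostAllGraphs P := by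
  classical
  have h' := h.const_sub 1
  rw [sub_zero] at h'
  refine h'.congr fun n => ?_
  have hpos := card_graph_pos n
  have hc : Nat.card {G : SimpleGraph (Fin n) // P n G} +
      Nat.card {G : SimpleGraph (Fin n) // ¬ P n G} = Nat.card (SimpleGraph (Fin n)) := by
    rw [← Nat.card_sum]
    exact Nat.card_congr (Equiv.sumCompl _)
  unfold failRatio
  rw [eq_div_iff hpos.ne', sub_mul, div_mul_cancel₀ _ hpos.ne', ← hc]
  push_cast
  ring

theorem failRatio_le_add {P Q R : ∀ n : ℕ, SimpleGraph (Fin n) → Prop} {n : ℕ}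
    (h : ∀ G, P n G → Q n G → R n G) : failRatio R n ≤ failRatio P n + failRatio Q n := by
  classical
  unfold failRatio
  rw [← add_div]
  refine div_le_div_of_nonneg_right ?_ (card_graph_pos n).le
  norm_cast
  simp only [Nat.card_eq_fintype_card, Fintype.card_subtype]
  refine le_trans (Finset.card_le_card ?_) (Finset.card_union_le _ _)
  intro G hG
  simp only [Finset.mem_filter, Finset.mem_univ, true_and, Finset.mem_union] at hG ⊢
  have := h G
  tauto

/-! ### Perfect matchings of non-edges -/

/-- The vertices `0, …, ⌊n/2⌋ - 1`. -/
def leftHalf (n : ℕ) (i : Fin (n / 2)) : Fin n := ⟨i, by omega⟩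

/-- The vertices `⌊n/2⌋, …, 2⌊n/2⌋ - 1`. -/
def rightHalf (n : ℕ) (i : Fin (n / 2)) : Fin n := ⟨n / 2 + i, by omega⟩

/-- The non-edges of `G` contain a perfect matching between the two halves of the vertex set. -/
def HasNonEdgeMatching (n : ℕ) (G : SimpleGraph (Fin n)) : Prop :=
  ∃ f : Equiv.Perm (Fin (n / 2)), ∀ i, ¬ G.Adj (leftHalf n i) (rightHalf n (f i))

/-- The obstruction given by Hall's theorem, for a relation that must be avoided. -/
theorem exists_complete_rectangle {t : ℕ} (R : Fin t → Fin t → Prop)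
    (h : ¬ ∃ f : Equiv.Perm (Fin t), ∀ i, ¬ R i (f i)) :
    ∃ S T : Finset (Fin t), S.card + T.card = t + 1 ∧ ∀ i ∈ S, ∀ j ∈ T, R i j := by
  classical
  by_contra hcon
  apply h
  have hall := (Finset.all_card_le_biUnion_card_iff_exists_injective
    (fun i : Fin t => Finset.univ.filter fun j => ¬ R i j)).1 ?_
  · obtain ⟨f, hf, hR⟩ := hall
    refine ⟨Equiv.ofBijective f (Finite.injective_iff_bijective.1 hf), fun i => ?_⟩
    simpa using hR i
  · intro S
    by_contra hlt
    push Not at hlt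
    -- S violates Hall's condition, so at least t + 1 - |S| elements lie outside its neighbourhood
    -- N, and each is related by R to all of S.
    set N := S.biUnion fun i : Fin t => Finset.univ.filter fun j => ¬ R i j with hN
    have hS : S.card ≤ t := by simpa using S.card_le_univ
    have hc : t + 1 - S.card ≤ Nᶜ.card := by
      rw [Finset.card_compl, Fintype.card_fin]
      omega
    obtain ⟨T, hT, hTc⟩ := Finset.exists_subset_card_eq hc
    refine hcon ⟨S, T, by omega, fun i hi j hj => ?_⟩
    by_contra hij
    have := hT hj
    rw [Finset.mem_compl] at this
    exact this (Finset.mem_biUnion.2 ⟨i, hi, by simpa using hij⟩)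

theorem card_complete_rectangle_le (n : ℕ) (S T : Finset (Fin (n / 2))) :
    (Nat.card {G : SimpleGraph (Fin n) //
        ∀ i ∈ S, ∀ j ∈ T, G.Adj (leftHalf n i) (rightHalf n j)} : ℝ) ≤
      (1 / 2) ^ (S.card * T.card) * Nat.card (SimpleGraph (Fin n)) := by
  have h := card_graph_trace_mul_le
    (fun p : S × T => s(leftHalf n p.1, rightHalf n p.2)) ?_ ?_ {Set.univ}
  · have hcard : Nat.card {G : SimpleGraph (Fin n) //
        ∀ i ∈ S, ∀ j ∈ T, G.Adj (leftHalf n i) (rightHalf n j)} * 2 ^ (S.card * T.card) ≤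
          Nat.card (SimpleGraph (Fin n)) := by
      simpa [Set.eq_univ_iff_forall] using h
    have hcard' : (Nat.card {G : SimpleGraph (Fin n) //
        ∀ i ∈ S, ∀ j ∈ T, G.Adj (leftHalf n i) (rightHalf n j)} : ℝ) * 2 ^ (S.card * T.card) ≤
          Nat.card (SimpleGraph (Fin n)) := by exact_mod_cast hcard
    rw [one_div, inv_pow, mul_comm, ← div_eq_mul_inv, le_div_iff₀ (by positivity)]
    exact hcard'
  · rintro ⟨⟨i, hi⟩, ⟨j, hj⟩⟩ ⟨⟨i', hi'⟩, ⟨j', hj'⟩⟩ hp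
    simp only [Sym2.eq_iff, leftHalf, rightHalf, Fin.mk.injEq] at hp
    simp only [Prod.mk.injEq, Subtype.mk.injEq, Fin.ext_iff]
    omega
  · rintro ⟨⟨i, hi⟩, ⟨j, hj⟩⟩ hp
    simp only [Sym2.mk_isDiag_iff, leftHalf, rightHalf, Fin.mk.injEq] at hp
    omega

/-- As b = t - (a - 1), symmetry replaces the second factor by t.choose (a - 1), so the bound
depends on the smaller side only. -/
theorem choose_mul_choose_le {t a b : ℕ} (hab : a + b = t + 1) (ha : 1 ≤ a) :
    t.choose a * t.choose b ≤ (t ^ 2) ^ a := by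
  have hb : t.choose b = t.choose (a - 1) := by
    rw [← Nat.choose_symm (by omega : b ≤ t)]
    congr 1
    omega
  rcases Nat.eq_zero_or_pos t with rfl | ht
  · rw [Nat.choose_eq_zero_of_lt (by omega : 0 < a)]
    simp
  rw [hb, ← pow_mul, two_mul, pow_add]
  exact Nat.mul_le_mul (Nat.choose_le_pow _ _)
    ((Nat.choose_le_pow _ _).trans (Nat.pow_le_pow_right ht (Nat.sub_le _ _)))

/-- The longer side satisfies b ≥ t/2, so the term is at most q ^ a with q = t²(1/2)^(t/2) ≤ 1,
hence at most q. -/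
theorem rectangle_term_le {t a b : ℕ} (hab : a + b = t + 1) (ha : 1 ≤ a) (hle : a ≤ b)
    (hq : (t : ℝ) ^ 2 * (1 / 2) ^ (t / 2) ≤ 1) :
    (t.choose a * t.choose b : ℝ) * (1 / 2) ^ (a * b) ≤ (t : ℝ) ^ 2 * (1 / 2) ^ (t / 2) := by
  have h₁ : (t.choose a * t.choose b : ℝ) ≤ ((t : ℝ) ^ 2) ^ a := by
    exact_mod_cast choose_mul_choose_le hab ha
  have h₂ : ((1 : ℝ) / 2) ^ (a * b) ≤ ((1 / 2) ^ (t / 2)) ^ a := by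
    rw [← pow_mul, mul_comm a b]
    exact pow_le_pow_of_le_one (by norm_num) (by norm_num)
      (Nat.mul_le_mul_right _ (by omega))
  calc _ ≤ ((t : ℝ) ^ 2) ^ a * ((1 / 2) ^ (t / 2)) ^ a := by gcongr
    _ = ((t : ℝ) ^ 2 * (1 / 2) ^ (t / 2)) ^ a := by rw [mul_pow]
    _ ≤ _ := pow_le_of_le_one (by positivity) hq (by omega)

/-- Union bound over the complete rectangles with sides a and t + 1 - a. Both sides are at most t,
so 1 ≤ a ≤ t, and these t values give the third factor t. -/
theorem failRatio_hasNonEdgeMatching_le (n : ℕ)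
    (hq : ((n / 2 : ℕ) : ℝ) ^ 2 * (1 / 2) ^ (n / 2 / 2) ≤ 1) :
    failRatio HasNonEdgeMatching n ≤ ((n / 2 : ℕ) : ℝ) ^ 3 * (1 / 2) ^ (n / 2 / 2) := by
  classical
  unfold failRatio
  rw [div_le_iff₀ (card_graph_pos n)]
  set t := n / 2 with ht
  set M : ℝ := ((Nat.card (SimpleGraph (Fin n)) : ℕ) : ℝ)
  let bad (p : Finset (Fin t) × Finset (Fin t)) : Finset (SimpleGraph (Fin n)) :=
    Finset.univ.filter fun G => ∀ i ∈ p.1, ∀ j ∈ p.2, G.Adj (leftHalf n i) (rightHalf n j)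
  have hbad (p) : ((bad p).card : ℝ) ≤ (1 / 2) ^ (p.1.card * p.2.card) * M := by
    have := card_complete_rectangle_le n p.1 p.2
    rwa [Nat.card_eq_fintype_card, Fintype.card_subtype] at this
  let I (a : ℕ) : Finset (Finset (Fin t) × Finset (Fin t)) :=
    Finset.univ.powersetCard a ×ˢ Finset.univ.powersetCard (t + 1 - a)
  have hsub : (Finset.univ.filter fun G => ¬ HasNonEdgeMatching n G) ⊆
      (Finset.Icc 1 t).biUnion fun a => (I a).biUnion bad := by
    intro G hG
    obtain ⟨S, T, hST, hA⟩ := exists_complete_rectangle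
      (fun i j => G.Adj (leftHalf n i) (rightHalf n j)) (Finset.mem_filter.1 hG).2
    have hS : S.card ≤ t := by simpa using S.card_le_univ
    have hT : T.card ≤ t := by simpa using T.card_le_univ
    simp only [Finset.mem_biUnion]
    refine ⟨S.card, Finset.mem_Icc.2 ⟨by omega, hS⟩, (S, T), ?_, ?_⟩
    · simp only [I, Finset.mem_product, Finset.mem_powersetCard, Finset.subset_univ, true_and]
      omega
    · simpa [bad] using hA
  have hterm : ∀ a ∈ Finset.Icc 1 t, ((((I a).biUnion bad).card : ℕ) : ℝ) ≤
      ((t : ℝ) ^ 2 * (1 / 2) ^ (t / 2)) * M := by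
    intro a ha
    rw [Finset.mem_Icc] at ha
    have h₁ : ((((I a).biUnion bad).card : ℕ) : ℝ) ≤ ∑ p ∈ I a, ((bad p).card : ℝ) := by
      exact_mod_cast Finset.card_biUnion_le
    have h₂ : ∑ p ∈ I a, ((bad p).card : ℝ) ≤ ∑ p ∈ I a, (1 / 2) ^ (a * (t + 1 - a)) * M := by
      refine Finset.sum_le_sum fun p hp => ?_
      simp only [I, Finset.mem_product, Finset.mem_powersetCard] at hp
      have := hbad p
      rwa [hp.1.2, hp.2.2] at this
    refine (h₁.trans h₂).trans ?_
    rw [Finset.sum_const, nsmul_eq_mul, ← mul_assoc]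
    refine mul_le_mul_of_nonneg_right ?_ (card_graph_pos n).le
    simp only [I, Finset.card_product, Finset.card_powersetCard, Finset.card_univ,
      Fintype.card_fin, Nat.cast_mul]
    rcases le_total a (t + 1 - a) with h | h
    · exact rectangle_term_le (by omega) ha.1 h hq
    · rw [mul_comm (t.choose a : ℝ), mul_comm a]
      exact rectangle_term_le (by omega) (by omega) h hq
  rw [Nat.card_eq_fintype_card, Fintype.card_subtype]
  calc (((Finset.univ.filter fun G => ¬ HasNonEdgeMatching n G).card : ℕ) : ℝ)
      ≤ ∑ a ∈ Finset.Icc 1 t, ((((I a).biUnion bad).card : ℕ) : ℝ) := by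
        exact_mod_cast (Finset.card_le_card hsub).trans Finset.card_biUnion_le
    _ ≤ ∑ a ∈ Finset.Icc 1 t, ((t : ℝ) ^ 2 * (1 / 2) ^ (t / 2)) * M := Finset.sum_le_sum hterm
    _ = (t : ℝ) ^ 3 * (1 / 2) ^ (t / 2) * M := by
        rw [Finset.sum_const, nsmul_eq_mul, Nat.card_Icc, Nat.add_sub_cancel]
        ring

theorem tendsto_pow_mul_half_pow_div_two (k : ℕ) :
    Tendsto (fun t : ℕ => (t : ℝ) ^ k * (1 / 2) ^ (t / 2)) atTop (𝓝 0) := by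
  have h₁ : Tendsto (fun m : ℕ => (m : ℝ) ^ k * (1 / 2) ^ m) atTop (𝓝 0) :=
    tendsto_pow_const_mul_const_pow_of_abs_lt_one k (by norm_num [abs_lt])
  have h₂ : Tendsto (fun t : ℕ => t / 2) atTop atTop :=
    Nat.tendsto_div_const_atTop (by norm_num)
  -- The factor 4 ^ k absorbs the rounding: t ≤ 4⌊t/2⌋ once t ≥ 2.
  have h₃ := (h₁.comp h₂).const_mul ((4 : ℝ) ^ k)
  rw [mul_zero] at h₃
  refine squeeze_zero' (Eventually.of_forall fun t => by positivity) ?_ h₃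
  filter_upwards [eventually_ge_atTop 2] with t ht
  have : (t : ℝ) ≤ 4 * ((t / 2 : ℕ) : ℝ) := by
    have : t ≤ 4 * (t / 2) := by omega
    exact_mod_cast this
  simp only [Function.comp]
  rw [← mul_assoc, ← mul_pow]
  gcongr

theorem tendsto_failRatio_hasNonEdgeMatching :
    Tendsto (failRatio HasNonEdgeMatching) atTop (𝓝 0) := by
  have hdiv : Tendsto (fun n : ℕ => n / 2) atTop atTop :=
    Nat.tendsto_div_const_atTop (by norm_num)
  refine squeeze_zero' (Eventually.of_forall fun n => failRatio_nonneg _ n) ?_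
    ((tendsto_pow_mul_half_pow_div_two 3).comp hdiv)
  have h := ((tendsto_pow_mul_half_pow_div_two 2).comp hdiv).eventually_le_const one_pos
  filter_upwards [h] with n hn
  exact failRatio_hasNonEdgeMatching_le n hn

/-! ### Large maximum degree -/

/-- The factor 2m + 1 closes the induction, because (2m+3)(2m+1) ≤ 4(m+1)². -/
theorem succ_mul_centralBinom_sq_le (m : ℕ) : (2 * m + 1) * m.centralBinom ^ 2 ≤ 16 ^ m := by
  induction m with
  | zero => simp
  | succ m ih =>
    have h := Nat.succ_mul_centralBinom_succ m
    set c := (m + 1).centralBinom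
    set d := m.centralBinom
    have hsq : ((m + 1) * c) ^ 2 = (2 * (2 * m + 1) * d) ^ 2 := by rw [h]
    refine Nat.le_of_mul_le_mul_left (c := (m + 1) ^ 2) ?_ (by positivity)
    calc (m + 1) ^ 2 * ((2 * (m + 1) + 1) * c ^ 2)
        = (2 * m + 3) * ((m + 1) * c) ^ 2 := by ring
      _ = 4 * ((2 * m + 3) * (2 * m + 1)) * ((2 * m + 1) * d ^ 2) := by rw [hsq]; ring
      _ ≤ 4 * (4 * (m + 1) ^ 2) * 16 ^ m := by
          have : (2 * m + 3) * (2 * m + 1) ≤ 4 * (m + 1) ^ 2 := by nlinarith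
          exact Nat.mul_le_mul (Nat.mul_le_mul_left _ this) ih
      _ = (m + 1) ^ 2 * 16 ^ (m + 1) := by ring

theorem succ_mul_choose_half_sq_le (N : ℕ) : (N + 1) * N.choose (N / 2) ^ 2 ≤ 4 ^ N := by
  rcases Nat.even_or_odd' N with ⟨m, rfl | rfl⟩
  · have := succ_mul_centralBinom_sq_le m
    rw [Nat.centralBinom] at this
    rw [Nat.mul_div_cancel_left m two_pos, pow_mul]
    exact this
  · have h := succ_mul_centralBinom_sq_le (m + 1)
    have h2 : (m + 1).centralBinom = 2 * (2 * m + 1).choose m := by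
      rw [Nat.centralBinom, show 2 * (m + 1) = 2 * m + 1 + 1 by ring, Nat.choose_succ_succ,
        ← Nat.choose_symm_half m]
      ring
    rw [h2] at h
    rw [show (2 * m + 1) / 2 = m by omega]
    have h3 : 4 ^ (2 * m + 1) * 4 = 16 ^ (m + 1) := by
      rw [show (16 : ℕ) = 4 ^ 2 by norm_num, ← pow_mul, ← pow_succ]
      congr 1
    nlinarith [Nat.zero_le ((2 * m + 1).choose m ^ 2)]

/-- At most about half of the subsets have size slightly above the average, or below it. -/
theorem card_small_sets_le (N s : ℕ) (hN : 16 * s ^ 2 ≤ N + 1) :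
    4 * (Finset.univ.filter fun T : Finset (Fin N) => 2 * T.card < N + s).card ≤ 3 * 2 ^ N := by
  classical
  -- Complementation shows that L is at most half of all subsets. J is a window of at most s sizes,
  -- each with at most a middle binomial coefficient of sets, which adds at most a quarter.
  set L := Finset.univ.filter fun T : Finset (Fin N) => 2 * T.card < N
  set J := (Finset.range (N + s)).filter fun j => N ≤ 2 * j ∧ 2 * j < N + s
  have hL : 2 * L.card ≤ 2 ^ N := by
    set U := Finset.univ.filter fun T : Finset (Fin N) => N < 2 * T.card
    have hLU : L.card ≤ U.card := by
      refine Finset.card_le_card_of_injOn (fun T => Tᶜ) ?_ (compl_injective.injOn)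
      intro T hT
      have h1 : 2 * T.card < N := by simpa [L] using hT
      have h2 : N < 2 * Tᶜ.card := by
        rw [Finset.card_compl, Fintype.card_fin]
        omega
      simpa [U] using h2
    have hd : Disjoint L U := by
      rw [Finset.disjoint_left]
      intro T h1 h2
      simp only [L, U, Finset.mem_filter] at h1 h2
      omega
    have := Finset.card_le_univ (L ∪ U)
    rw [Finset.card_union_of_disjoint hd, Fintype.card_finset, Fintype.card_fin] at this
    omega
  have hJ : J.card ≤ s := by
    have : J ⊆ Finset.Ico ((N + 1) / 2) ((N + 1) / 2 + s) := by
      intro j hj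
      simp only [J, Finset.mem_filter, Finset.mem_Ico] at hj ⊢
      omega
    simpa using Finset.card_le_card this
  have hsub : (Finset.univ.filter fun T : Finset (Fin N) => 2 * T.card < N + s) ⊆
      L ∪ J.biUnion fun j => Finset.univ.powersetCard j := by
    intro T hT
    simp only [Finset.mem_filter, Finset.mem_univ, true_and] at hT
    simp only [L, J, Finset.mem_union, Finset.mem_biUnion, Finset.mem_filter, Finset.mem_univ,
      true_and, Finset.mem_powersetCard, Finset.subset_univ, Finset.mem_range, exists_eq_right']
    omega
  have hmid : (J.biUnion fun j => (Finset.univ : Finset (Fin N)).powersetCard j).card ≤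
      s * N.choose (N / 2) := by
    refine Finset.card_biUnion_le.trans ((Finset.sum_le_card_nsmul J _ (N.choose (N / 2)) ?_).trans
      (Nat.mul_le_mul_right _ hJ))
    intro j _
    rw [Finset.card_powersetCard, Finset.card_univ, Fintype.card_fin]
    exact Nat.choose_le_middle _ _
  have hc : 4 * (s * N.choose (N / 2)) ≤ 2 ^ N := by
    refine (Nat.pow_le_pow_iff_left two_ne_zero).1 ?_
    calc (4 * (s * N.choose (N / 2))) ^ 2 = 16 * s ^ 2 * N.choose (N / 2) ^ 2 := by ring
      _ ≤ (N + 1) * N.choose (N / 2) ^ 2 := Nat.mul_le_mul_right _ hN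
      _ ≤ 4 ^ N := succ_mul_choose_half_sq_le N
      _ = (2 ^ N) ^ 2 := by rw [← pow_mul, mul_comm, pow_mul]; norm_num
  have := (Finset.card_le_card hsub).trans (Finset.card_union_le _ _)
  omega

open Classical in
/-- The maximum degree exceeds half the number of vertices by at least two. -/
def HasLargeMaxDegree (n : ℕ) (G : SimpleGraph (Fin n)) : Prop :=
  n + 4 ≤ 2 * G.maxDegree

/-- The neighbourhoods of the first s vertices among the other N are independent, and each is too
small with probability at most 3/4. The excess s + 4 turns N into the required n + 4. -/
theorem failRatio_hasLargeMaxDegree_le (s N : ℕ) (hN : 16 * (s + 4) ^ 2 ≤ N + 1) :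
    failRatio HasLargeMaxDegree (s + N) ≤ (3 / 4) ^ s := by
  classical
  let e (p : Fin s × Fin N) : Sym2 (Fin (s + N)) := s(Fin.castAdd N p.1, Fin.natAdd s p.2)
  let D := {T : Finset (Fin N) // 2 * T.card < N + (s + 4)}
  let Q : Set (Set (Fin s × Fin N)) :=
    {X | ∀ i, 2 * (Finset.univ.filter fun j => (i, j) ∈ X).card < N + (s + 4)}
  have hcount := card_graph_trace_mul_le e ?_ ?_ Q
  · have hQ : Nat.card Q ≤ Nat.card D ^ s := by
      have : Nat.card (Fin s → D) = Nat.card D ^ s := by simp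
      rw [← this]
      refine Nat.card_le_card_of_injective
        (fun X : Q => fun i => (⟨Finset.univ.filter fun j => (i, j) ∈ X.1, X.2 i⟩ : D)) ?_
      rintro ⟨X, hX⟩ ⟨Y, hY⟩ h
      ext ⟨i, j⟩
      have hi := congrArg Subtype.val (congrFun h i)
      simpa using Finset.ext_iff.1 hi j
    have hD : 4 * Nat.card D ≤ 3 * 2 ^ N := by
      rw [Nat.card_eq_fintype_card, Fintype.card_subtype]
      exact card_small_sets_le N (s + 4) hN
    have hsub : Nat.card {G : SimpleGraph (Fin (s + N)) // ¬ HasLargeMaxDegree (s + N) G} ≤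
        Nat.card {G : SimpleGraph (Fin (s + N)) // {p | e p ∈ G.edgeSet} ∈ Q} := by
      refine Nat.card_le_card_of_injective (Subtype.map id ?_)
        (Subtype.map_injective _ Function.injective_id)
      intro G hG i
      have hdeg : (Finset.univ.filter fun j => (i, j) ∈ {p | e p ∈ G.edgeSet}).card ≤
          G.maxDegree := by
        refine le_trans ?_ (G.degree_le_maxDegree (Fin.castAdd N i))
        rw [← G.card_neighborFinset_eq_degree]
        refine Finset.card_le_card_of_injOn (Fin.natAdd s) ?_
          (Fin.natAdd_injective N s).injOn
        intro j hj
        simpa [e] using hj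
      simp only [HasLargeMaxDegree, not_le] at hG
      simp only [id]
      omega
    set M := Nat.card (SimpleGraph (Fin (s + N))) with hM
    have hDr : (Nat.card D : ℝ) ≤ 3 / 4 * 2 ^ N := by
      have : (4 : ℝ) * Nat.card D ≤ 3 * 2 ^ N := by exact_mod_cast hD
      linarith
    have hpow : (Nat.card D : ℝ) ^ s ≤ (3 / 4) ^ s * (2 ^ N) ^ s := by
      rw [← mul_pow]
      exact pow_le_pow_left₀ (Nat.cast_nonneg _) hDr s
    have hmain : (Nat.card {G : SimpleGraph (Fin (s + N)) // ¬ HasLargeMaxDegree (s + N) G} : ℝ) *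
        (2 ^ N) ^ s ≤ (Nat.card D : ℝ) ^ s * M := by
      have h2 : 2 ^ Fintype.card (Fin s × Fin N) = (2 ^ N) ^ s := by
        rw [Fintype.card_prod, Fintype.card_fin, Fintype.card_fin, mul_comm, pow_mul]
      rw [h2] at hcount
      exact_mod_cast (Nat.mul_le_mul_right _ hsub).trans
        (hcount.trans (Nat.mul_le_mul_right _ hQ))
    unfold failRatio
    rw [div_le_iff₀ (card_graph_pos _)]
    have hM0 : (0 : ℝ) ≤ M := Nat.cast_nonneg _
    refine le_of_mul_le_mul_right (hmain.trans ?_) (by positivity : (0 : ℝ) < (2 ^ N) ^ s)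
    calc (Nat.card D : ℝ) ^ s * M ≤ (3 / 4) ^ s * (2 ^ N) ^ s * M := by gcongr
      _ = _ := by ring
  · rintro ⟨i, j⟩ ⟨i', j'⟩ hp
    simp only [e, Sym2.eq_iff, Fin.ext_iff, Fin.val_castAdd, Fin.val_natAdd] at hp
    simp only [Prod.mk.injEq, Fin.ext_iff]
    omega
  · rintro ⟨i, j⟩ hp
    simp only [e, Sym2.mk_isDiag_iff, Fin.ext_iff, Fin.val_castAdd, Fin.val_natAdd] at hp
    omega

theorem tendsto_failRatio_hasLargeMaxDegree :
    Tendsto (failRatio HasLargeMaxDegree) atTop (𝓝 0) := by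
  rw [Metric.tendsto_atTop]
  intro ε hε
  obtain ⟨s, hs⟩ := exists_pow_lt_of_lt_one hε (by norm_num : (3 / 4 : ℝ) < 1)
  refine ⟨s + 16 * (s + 4) ^ 2, fun n hn => ?_⟩
  obtain ⟨N, rfl⟩ := Nat.exists_eq_add_of_le (le_of_add_le_left hn)
  rw [Real.dist_0_eq_abs, abs_of_nonneg (failRatio_nonneg _ _)]
  exact (failRatio_hasLargeMaxDegree_le s N (by omega)).trans_lt hs

/-! ### Averages over random permutations -/

section PermSums

open Nat

variable {t : ℕ}

theorem card_mul_sum_perm_apply (g : Fin t → ℤ) (i : Fin t) :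
    (t : ℤ) * ∑ σ : Equiv.Perm (Fin t), g (σ i) = (t ! : ℤ) * ∑ a, g a := by
  have h (j : Fin t) : ∑ σ : Equiv.Perm (Fin t), g (σ j) = ∑ σ : Equiv.Perm (Fin t), g (σ i) := by
    rw [← Equiv.sum_comp (Equiv.mulRight (Equiv.swap i j))]
    simp
  calc (t : ℤ) * ∑ σ : Equiv.Perm (Fin t), g (σ i)
      = ∑ j : Fin t, ∑ σ : Equiv.Perm (Fin t), g (σ j) := by
        rw [Finset.sum_congr rfl fun j _ => h j]
        simp
    _ = ∑ σ : Equiv.Perm (Fin t), ∑ j : Fin t, g (σ j) := Finset.sum_comm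
    _ = ∑ _σ : Equiv.Perm (Fin t), ∑ a, g a :=
        Finset.sum_congr rfl fun σ _ => Equiv.sum_comp σ g
    _ = (t ! : ℤ) * ∑ a, g a := by
        simp [Fintype.card_perm]

/-- By symmetry the average is the same for all k ≠ i in place of j. Summing over k leaves y (σ i)
times the total minus y (σ i). -/
theorem card_mul_sum_perm_apply_mul_apply (y : Fin t → ℤ) {i j : Fin t} (hij : i ≠ j) :
    (t : ℤ) * ((t : ℤ) - 1) * ∑ σ : Equiv.Perm (Fin t), y (σ i) * y (σ j) =
      (t ! : ℤ) * ((∑ a, y a) ^ 2 - ∑ a, y a ^ 2) := by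
  have h (k : Fin t) (hk : k ∈ Finset.univ.erase i) :
      ∑ σ : Equiv.Perm (Fin t), y (σ i) * y (σ k) =
        ∑ σ : Equiv.Perm (Fin t), y (σ i) * y (σ j) := by
    rw [← Equiv.sum_comp (Equiv.mulRight (Equiv.swap j k))]
    simp [Equiv.swap_apply_of_ne_of_ne hij (Finset.ne_of_mem_erase hk).symm]
  have h₁ : ((t : ℤ) - 1) * ∑ σ : Equiv.Perm (Fin t), y (σ i) * y (σ j) =
      (∑ a, y a) * ∑ σ : Equiv.Perm (Fin t), y (σ i) -
        ∑ σ : Equiv.Perm (Fin t), y (σ i) ^ 2 := by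
    calc ((t : ℤ) - 1) * ∑ σ : Equiv.Perm (Fin t), y (σ i) * y (σ j)
        = ∑ k ∈ Finset.univ.erase i, ∑ σ : Equiv.Perm (Fin t), y (σ i) * y (σ k) := by
          rw [Finset.sum_congr rfl h, Finset.sum_const,
            Finset.card_erase_of_mem (Finset.mem_univ i), Finset.card_univ, Fintype.card_fin,
            nsmul_eq_mul, Nat.cast_sub (Nat.one_le_iff_ne_zero.2 (by rintro rfl; exact i.elim0)),
            Nat.cast_one]
      _ = ∑ σ : Equiv.Perm (Fin t), ∑ k ∈ Finset.univ.erase i, y (σ i) * y (σ k) :=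
          Finset.sum_comm
      _ = ∑ σ : Equiv.Perm (Fin t), ((∑ a, y a) * y (σ i) - y (σ i) ^ 2) := by
          refine Finset.sum_congr rfl fun σ _ => ?_
          rw [← Finset.mul_sum, Finset.sum_erase_eq_sub (Finset.mem_univ i),
            Equiv.sum_comp σ y]
          ring
      _ = _ := by rw [Finset.sum_sub_distrib, Finset.mul_sum]
  have h₂ := card_mul_sum_perm_apply y i
  have h₃ := card_mul_sum_perm_apply (fun a => y a ^ 2) i
  linear_combination (t : ℤ) * h₁ + (∑ a, y a) * h₂ - h₃

end PermSums

/-! ### Random balanced signs -/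

/-- Signs for `t` pairs of vertices, where `0` stands for a pair that is split: the signs add up
to `-r`, and at most one pair is split. -/
structure IsSignPattern {t : ℕ} (r : ℕ) (y : Fin t → ℤ) : Prop where
  values : ∀ i, y i = 1 ∨ y i = -1 ∨ y i = 0
  sum_eq : ∑ i, y i = -(r : ℤ)
  sum_sq : (t : ℤ) - 1 ≤ ∑ i, y i ^ 2
  split_unique : ∀ i j, i ≠ j → (1 - y i ^ 2) * (1 - y j ^ 2) = 0

theorem exists_isSignPattern {t r : ℕ} (hr : r ≤ t) : ∃ y : Fin t → ℤ, IsSignPattern r y := by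
  -- There are m plus signs, m + r minus signs and q zeros, where q is the parity of t - r.
  obtain ⟨m, q, hq, rfl⟩ : ∃ m q, q ≤ 1 ∧ t = m + (m + r) + q :=
    ⟨(t - r) / 2, (t - r) % 2, by omega, by omega⟩
  let f (i : ℕ) : ℤ := if i < m then 1 else if i < m + (m + r) then -1 else 0
  have hsum (g : ℤ → ℤ) : ∑ i : Fin (m + (m + r) + q), g (f i) =
      m * g 1 + (m + r) * g (-1) + q * g 0 := by
    rw [Fin.sum_univ_eq_sum_range (fun i => g (f i)), Finset.sum_range_add, Finset.sum_range_add]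
    have h₁ : ∑ x ∈ Finset.range m, g (f x) = m * g 1 := by
      rw [Finset.sum_congr rfl fun x hx => by
        rw [show f x = 1 by simp [f, Finset.mem_range.1 hx]]]
      simp
    have h₂ : ∑ x ∈ Finset.range (m + r), g (f (m + x)) = (m + r) * g (-1) := by
      rw [Finset.sum_congr rfl fun x hx => by
        rw [show f (m + x) = -1 by have := Finset.mem_range.1 hx; simp [f, this]]]
      simp
    have h₃ : ∑ x ∈ Finset.range q, g (f (m + (m + r) + x)) = q * g 0 := by
      rw [Finset.sum_congr rfl fun x _ => by
        rw [show f (m + (m + r) + x) = 0 by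
          simp only [f]
          rw [if_neg (by omega), if_neg (by omega)]]]
      simp
    rw [h₁, h₂, h₃]
  refine ⟨fun i => f i, ⟨fun i => ?_, ?_, ?_, fun i j hij => ?_⟩⟩
  · simp only [f]
    split_ifs <;> simp
  · have := hsum id
    simp only [id] at this
    rw [this]
    ring
  · rw [hsum fun x => x ^ 2]
    push_cast
    have : (q : ℤ) ≤ 1 := by exact_mod_cast hq
    linarith
  · have hij' : (i : ℕ) ≠ j := fun h => hij (Fin.ext h)
    have hi := i.isLt
    have hj := j.isLt
    simp only [f]
    split_ifs <;> omega

/-- The sign `±1` attached to a Boolean. -/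
def boolSign (b : Bool) : ℤ := if b then 1 else -1

/-- The side of each vertex, when the vertices form `t` pairs and `r` further vertices and the
signs `y`, permuted by `σ`, are given to the pairs. -/
def spin {t r : ℕ} (y : Fin t → ℤ) (p : Equiv.Perm (Fin t) × Bool) :
    (Fin t × Bool) ⊕ Fin r → ℤ
  | .inl (i, b) => y (p.1 i) + boolSign p.2 * boolSign b * (1 - y (p.1 i) ^ 2)
  | .inr _ => 1

section Spin

open Nat

variable {t r : ℕ} {y : Fin t → ℤ}

theorem spin_eq_one_or (hy : IsSignPattern r y) (p : Equiv.Perm (Fin t) × Bool)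
    (x : (Fin t × Bool) ⊕ Fin r) : spin y p x = 1 ∨ spin y p x = -1 := by
  rcases x with ⟨i, b⟩ | _
  · rcases hy.values (p.1 i) with h | h | h <;> rcases p with ⟨σ, _ | _⟩ <;> cases b <;>
      simp only at h <;> simp [spin, boolSign, h]
  · exact Or.inl rfl

/-- The pairs contribute 2·(-r) and the leftover vertices +r, which explains the choice of -r for
the sum of the signs. -/
theorem sum_spin (hy : IsSignPattern r y) (p : Equiv.Perm (Fin t) × Bool) :
    ∑ x : (Fin t × Bool) ⊕ Fin r, spin y p x = -(r : ℤ) := by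
  have h : ∑ i, y (p.1 i) = -(r : ℤ) := by rw [Equiv.sum_comp p.1 y, hy.sum_eq]
  have h' : ∑ i : Fin t, ∑ b : Bool, spin (r := r) y p (.inl (i, b)) = 2 * ∑ i, y (p.1 i) := by
    rw [Finset.mul_sum]
    refine Finset.sum_congr rfl fun i _ => ?_
    simp only [Fintype.sum_bool, spin, boolSign]
    simp
    ring
  rw [Fintype.sum_sum_type, Fintype.sum_prod_type, h', h]
  simp [spin]
  ring

/-- The mean product is at most -(t-2)/(t(t-1)). This is at most -1/(t+2) exactly when t² - 4 ≥ t² -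
t, that is, t ≥ 4; with t + 1 in place of t + 2 the comparison would fail. -/
theorem sum_spin_mul_spin_inl_inl (hy : IsSignPattern r y) (hr : r ≤ 1) (ht : 4 ≤ t)
    {i j : Fin t} (hij : i ≠ j) (b c : Bool) :
    ((t : ℤ) + 2) * ∑ p, spin (r := r) y p (.inl (i, b)) * spin (r := r) y p (.inl (j, c)) ≤
      -(2 * (t ! : ℤ)) := by
  have h : ∑ p, spin (r := r) y p (.inl (i, b)) * spin (r := r) y p (.inl (j, c)) =
      2 * ∑ σ : Equiv.Perm (Fin t), y (σ i) * y (σ j) := by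
    rw [Fintype.sum_prod_type, Finset.mul_sum]
    refine Finset.sum_congr rfl fun σ _ => ?_
    -- Terms linear in the random Boolean cancel, and the quadratic one vanishes because at most one
    -- pair is split.
    have := hy.split_unique (σ i) (σ j) (fun h => hij (σ.injective h))
    simp only [Fintype.sum_bool, spin, show boolSign true = 1 from rfl,
      show boolSign false = -1 from rfl]
    linear_combination 2 * boolSign b * boolSign c * this
  rw [h]
  have hC := card_mul_sum_perm_apply_mul_apply y hij
  set C := ∑ σ : Equiv.Perm (Fin t), y (σ i) * y (σ j)
  rw [hy.sum_eq] at hC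
  have hsq := hy.sum_sq
  have hr2 : (-(r : ℤ)) ^ 2 ≤ 1 := by
    interval_cases r <;> norm_num
  have ht' : (4 : ℤ) ≤ t := by exact_mod_cast ht
  have hF : (0 : ℤ) ≤ t ! := by positivity
  have h₁ : (t : ℤ) * (t - 1) * C ≤ (t ! : ℤ) * (-(t - 2)) := by
    rw [hC]
    exact mul_le_mul_of_nonneg_left (by linarith) hF
  have hpos : (0 : ℤ) < t * (t - 1) := mul_pos (by linarith) (by linarith)
  have h₂ : (t : ℤ) * (t - 1) * (((t : ℤ) + 2) * C) ≤ t * (t - 1) * (-(t ! : ℤ)) := by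
    calc (t : ℤ) * (t - 1) * (((t : ℤ) + 2) * C) = (t + 2) * (t * (t - 1) * C) := by ring
      _ ≤ (t + 2) * ((t ! : ℤ) * (-(t - 2))) :=
          mul_le_mul_of_nonneg_left h₁ (by linarith)
      _ = (t ! : ℤ) * (4 - t ^ 2) := by ring
      _ ≤ (t ! : ℤ) * (t - t ^ 2) := mul_le_mul_of_nonneg_left (by linarith) hF
      _ = _ := by ring
  linarith [le_of_mul_le_mul_left h₂ hpos]

/-- A leftover vertex has sign 1, so the mean product is the mean sign -r/t ≤ -1/t. -/
theorem sum_spin_mul_spin_inl_inr (hy : IsSignPattern r y) (i : Fin t) (b : Bool) (z : Fin r) :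
    ((t : ℤ) + 2) * ∑ p, spin (r := r) y p (.inl (i, b)) * spin y p (.inr z) ≤
      -(2 * (t ! : ℤ)) := by
  have h : ∑ p, spin (r := r) y p (.inl (i, b)) * spin y p (.inr z) =
      2 * ∑ σ : Equiv.Perm (Fin t), y (σ i) := by
    rw [Fintype.sum_prod_type, Finset.mul_sum]
    refine Finset.sum_congr rfl fun σ _ => ?_
    simp only [Fintype.sum_bool, spin, show boolSign true = 1 from rfl,
      show boolSign false = -1 from rfl]
    ring
  rw [h]
  have hC := card_mul_sum_perm_apply y i
  set C := ∑ σ : Equiv.Perm (Fin t), y (σ i)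
  rw [hy.sum_eq] at hC
  have hr : (1 : ℤ) ≤ r := by exact_mod_cast Fin.pos z
  have hF : (0 : ℤ) < t ! := by positivity
  have ht : (0 : ℤ) < t := by exact_mod_cast Fin.pos i
  have h₁ : (t : ℤ) * C ≤ -(t ! : ℤ) := by nlinarith
  have h₂ : C ≤ 0 := by
    by_contra hcon
    nlinarith
  linarith

/-- Two vertices that do not form a pair are on average negatively correlated. -/
theorem sum_spin_mul_spin_le (hy : IsSignPattern r y) (hr : r ≤ 1) (ht : 4 ≤ t)
    (u v : (Fin t × Bool) ⊕ Fin r) (huv : u ≠ v)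
    (hpair : ∀ i b, ¬ (u = .inl (i, b) ∧ v = .inl (i, !b))) :
    ((t : ℤ) + 2) * ∑ p, spin y p u * spin y p v ≤ -(2 * (t ! : ℤ)) := by
  rcases u with ⟨i, b⟩ | z <;> rcases v with ⟨j, c⟩ | z'
  · refine sum_spin_mul_spin_inl_inl hy hr ht ?_ b c
    rintro rfl
    rcases eq_or_ne c b with rfl | hcb
    · exact huv rfl
    · exact hpair i b ⟨rfl, by rw [Bool.eq_not_of_ne hcb]⟩
  · exact sum_spin_mul_spin_inl_inr hy i b z'
  · simp_rw [mul_comm (spin y _ (Sum.inr z))]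
    exact sum_spin_mul_spin_inl_inr hy j c z
  · exact absurd (congrArg Sum.inr (Fin.ext (by omega))) huv

end Spin

/-! ### From correlations to heavy bisections -/

open Classical in
/-- The vertices of positive sign. -/
noncomputable def positivePart {V : Type*} [Fintype V] (x : V → ℤ) : Finset V :=
  Finset.univ.filter fun v => x v = 1

theorem isBisection_positivePart {V : Type*} [Fintype V] {x : V → ℤ}
    (hx : ∀ v, x v = 1 ∨ x v = -1) (hsum : |∑ v, x v| ≤ 1) (hV : 2 ≤ Fintype.card V) :
    IsBisection (positivePart x) := by
  classical
  have hs : ∑ v, x v = ((positivePart x).card : ℤ) - ((positivePart x)ᶜ.card : ℤ) := by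
    rw [← Finset.sum_add_sum_compl (positivePart x)]
    rw [Finset.sum_congr (s₁ := positivePart x) (g := fun _ => (1 : ℤ)) rfl fun v hv => (Finset.mem_filter.1 hv).2]
    rw [Finset.sum_congr (s₁ := (positivePart x)ᶜ) (g := fun _ => (-1 : ℤ)) rfl fun v hv => by
      have : x v ≠ 1 := by simpa [positivePart] using hv
      exact (hx v).resolve_left this]
    simp
    ring
  have hc := Finset.card_add_card_compl (positivePart x)
  rw [hs] at hsum
  have hab := abs_le.1 hsum
  refine ⟨?_, ?_, by convert hsum⟩
  · rw [← Finset.card_pos]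
    omega
  · intro h
    rw [h] at hc hab
    simp only [Finset.card_univ, Finset.compl_univ, Finset.card_empty] at hc hab
    omega

theorem mem_cutEdges_positivePart {V : Type*} [Fintype V] {G : SimpleGraph V} {x : V → ℤ}
    {u v : V} (h : s(u, v) ∈ G.edgeSet) :
    (⟨s(u, v), h⟩ : G.edgeSet) ∈ cutEdges G (positivePart x) ↔
      (x u = 1 ∧ x v ≠ 1) ∨ (x v = 1 ∧ x u ≠ 1) := by
  simp only [cutEdges, Set.mem_ofPred_eq, positivePart, Finset.mem_filter, Finset.mem_univ,
    true_and, Sym2.eq_iff]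
  constructor
  · rintro ⟨a, ha, b, hb, ⟨rfl, rfl⟩ | ⟨rfl, rfl⟩⟩
    · exact Or.inl ⟨ha, hb⟩
    · exact Or.inr ⟨ha, hb⟩
  · rintro (⟨ha, hb⟩ | ⟨ha, hb⟩)
    · exact ⟨u, ha, v, hb, Or.inl ⟨rfl, rfl⟩⟩
    · exact ⟨v, ha, u, hb, Or.inr ⟨rfl, rfl⟩⟩

open Classical in
theorem two_mul_indicator_cutEdges {V : Type*} [Fintype V] {G : SimpleGraph V} {x : V → ℤ}
    (hx : ∀ v, x v = 1 ∨ x v = -1) {u v : V} (h : s(u, v) ∈ G.edgeSet) :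
    2 * (if (⟨s(u, v), h⟩ : G.edgeSet) ∈ cutEdges G (positivePart x) then (1 : ℤ) else 0) =
      1 - x u * x v := by
  simp only [mem_cutEdges_positivePart]
  rcases hx u with hu | hu <;> rcases hx v with hv | hv <;> simp [hu, hv]

/-- If every edge is cut by a proportion at least `c` of a family of bisections, then one of
these has weight at least `c * w(G)`. -/
theorem hasBisection_of_average {V P : Type*} [Fintype V] [Fintype P] [Nonempty P]
    (G : SimpleGraph V) (w : G.edgeSet → ℝ) (hw : ∀ e, 0 ≤ w e) (A : P → Finset V)
    (hA : ∀ p, IsBisection (A p)) (c : ℝ)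
    (hc : ∀ e : G.edgeSet, c * Fintype.card P ≤ Nat.card {p // e ∈ cutEdges G (A p)}) :
    HasBisectionOfWeightAtLeast G w (c * totalWeight G w) := by
  classical
  have hsum : ∑ _p : P, c * totalWeight G w ≤ ∑ p : P, cutWeight G w (A p) := by
    have h₁ : ∑ p : P, cutWeight G w (A p) =
        ∑ e : G.edgeSet, w e * (Nat.card {p // e ∈ cutEdges G (A p)} : ℝ) := by
      unfold cutWeight
      simp_rw [Finset.sum_filter]
      rw [Finset.sum_comm]
      refine Finset.sum_congr rfl fun e _ => ?_
      rw [← Finset.sum_filter, Finset.sum_const, nsmul_eq_mul, Nat.card_eq_fintype_card,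
        Fintype.card_subtype, mul_comm]
    rw [h₁, Finset.sum_const, Finset.card_univ, nsmul_eq_mul, totalWeight, ← mul_assoc,
      Finset.mul_sum]
    refine Finset.sum_le_sum fun e _ => ?_
    calc (Fintype.card P * c) * w e = w e * (c * Fintype.card P) := by ring
      _ ≤ _ := mul_le_mul_of_nonneg_left (hc e) (hw e)
  obtain ⟨p, -, hp⟩ := Finset.exists_le_of_sum_le Finset.univ_nonempty hsum
  exact ⟨A p, hA p, hp⟩

/-- A graph whose vertices, except for at most one, form `t` non-adjacent pairs has a heavy
bisection. -/
theorem hasBisection_of_pairing {V : Type*} [Fintype V] (G : SimpleGraph V)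
    {t r : ℕ} (ht : 4 ≤ t) (hr : r ≤ 1) (φ : V ≃ (Fin t × Bool) ⊕ Fin r)
    (hφ : ∀ i, ¬ G.Adj (φ.symm (.inl (i, true))) (φ.symm (.inl (i, false))))
    (w : G.edgeSet → ℝ) (hw : ∀ e, 0 ≤ w e) :
    HasBisectionOfWeightAtLeast G w
      ((1 / 2 + 1 / (2 * ((t : ℝ) + 2))) * totalWeight G w) := by
  classical
  obtain ⟨y, hy⟩ := exists_isSignPattern (t := t) (r := r) (by omega)
  have hx (p) (v : V) := spin_eq_one_or hy p (φ v)
  refine hasBisection_of_average G w hw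
    (fun p : Equiv.Perm (Fin t) × Bool => positivePart fun v => spin y p (φ v))
    (fun p => isBisection_positivePart (hx p) ?_ ?_) _ ?_
  · rw [Equiv.sum_comp φ (spin y p), sum_spin hy, abs_neg, Nat.abs_cast]
    exact_mod_cast hr
  · rw [Fintype.card_congr φ]
    simp
    omega
  · rintro ⟨e, he⟩
    induction e using Sym2.ind with
    | _ u v =>
      have hadj : G.Adj u v := he
      have hcorr := sum_spin_mul_spin_le hy hr ht (φ u) (φ v)
        (fun h => hadj.ne (φ.injective h)) ?_
      -- Sum twice the cut indicator, 1 - x u * x v, over all 2·t! outcomes.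
      · have hcount : 2 * (Nat.card {p : Equiv.Perm (Fin t) × Bool //
            (⟨s(u, v), he⟩ : G.edgeSet) ∈
              cutEdges G (positivePart fun v => spin y p (φ v))} : ℤ) =
            2 * (t.factorial : ℤ) - ∑ p, spin y p (φ u) * spin y p (φ v) := by
          rw [Nat.card_eq_fintype_card, Fintype.card_subtype, Finset.card_filter]
          push_cast
          rw [Finset.mul_sum, Finset.sum_congr rfl fun p _ => two_mul_indicator_cutEdges (hx p) he,
            Finset.sum_sub_distrib]
          simp [Fintype.card_perm]
          ring
        set c := Nat.card {p : Equiv.Perm (Fin t) × Bool // (⟨s(u, v), he⟩ : G.edgeSet) ∈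
              cutEdges G (positivePart fun v => spin y p (φ v))}
        have hint : 2 * (t.factorial : ℤ) * ((t : ℤ) + 2) + 2 * (t.factorial : ℤ) ≤
            2 * (c : ℤ) * ((t : ℤ) + 2) := by
          rw [hcount]
          linarith
        have hreal : 2 * (t.factorial : ℝ) * ((t : ℝ) + 2) + 2 * (t.factorial : ℝ) ≤
            2 * (c : ℝ) * ((t : ℝ) + 2) := by exact_mod_cast hint
        have hpos : (0 : ℝ) < (t : ℝ) + 2 := by positivity
        rw [Fintype.card_prod, Fintype.card_perm, Fintype.card_fin, Fintype.card_bool]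
        push_cast
        have : (1 / 2 + 1 / (2 * ((t : ℝ) + 2))) * ((t.factorial : ℝ) * 2) =
            (2 * (t.factorial : ℝ) * ((t : ℝ) + 2) + 2 * (t.factorial : ℝ)) /
              (2 * ((t : ℝ) + 2)) := by
          field_simp
        rw [this, div_le_iff₀ (by positivity)]
        linarith
      · rintro i b ⟨hu, hv⟩
        rw [← Equiv.eq_symm_apply] at hu hv
        subst hu hv
        cases b
        · exact hφ i hadj.symm
        · exact hφ i hadj

/-! ### Combining the two properties -/

/-- The vertices as pairs given by a matching of the two halves, plus the vertex left over if `n`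
is odd. -/
def pairingFun (n : ℕ) (f : Equiv.Perm (Fin (n / 2))) :
    (Fin (n / 2) × Bool) ⊕ Fin (n % 2) → Fin n
  | .inl (i, true) => leftHalf n i
  | .inl (i, false) => rightHalf n (f i)
  | .inr z => ⟨2 * (n / 2) + z, by omega⟩

theorem pairingFun_bijective (n : ℕ) (f : Equiv.Perm (Fin (n / 2))) :
    Function.Bijective (pairingFun n f) := by
  rw [Fintype.bijective_iff_injective_and_card]
  constructor
  · rintro (⟨i, _ | _⟩ | z) (⟨j, _ | _⟩ | z') h <;>
      simp only [pairingFun, leftHalf, rightHalf, Fin.mk.injEq] at h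
    · rw [f.injective (Fin.ext (by omega : (f i : ℕ) = f j))]
    · omega
    · omega
    · omega
    · rw [Fin.ext h]
    · omega
    · omega
    · omega
    · rw [Fin.ext (by omega : (z : ℕ) = z')]
  · simp
    omega

theorem HasBisectionOfWeightAtLeast.mono {V : Type*} [Fintype V] {G : SimpleGraph V}
    {w : G.edgeSet → ℝ} {c d : ℝ} (h : HasBisectionOfWeightAtLeast G w d) (hcd : c ≤ d) :
    HasBisectionOfWeightAtLeast G w c := by
  obtain ⟨A, hA, hd⟩ := h
  exact ⟨A, hA, hcd.trans hd⟩

theorem satisfiesBisectionBound_of_matching {n : ℕ} (hn : 8 ≤ n) {G : SimpleGraph (Fin n)}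
    (hM : HasNonEdgeMatching n G) (hD : HasLargeMaxDegree n G) (w : G.edgeSet → ℝ)
    (hw : ∀ e, 0 ≤ w e) : SatisfiesBisectionBound G w := by
  classical
  obtain ⟨f, hf⟩ := hM
  have hB := hasBisection_of_pairing G (by omega : 4 ≤ n / 2) (by omega : n % 2 ≤ 1)
    (Equiv.ofBijective _ (pairingFun_bijective n f)).symm (by simpa [pairingFun] using hf) w hw
  have hW : 0 ≤ totalWeight G w := Finset.sum_nonneg fun e _ => hw e
  intro k hk hkD
  -- The margin in the maximum degree is chosen to match the denominator t + 2 of the pairing bound.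
  have hk2 : n / 2 + 2 ≤ k := by
    have hD' : n + 4 ≤ 2 * k := hD.trans (Nat.mul_le_mul_left 2 (by convert hkD))
    omega
  have hkr : ((n / 2 : ℕ) : ℝ) + 2 ≤ k := by exact_mod_cast hk2
  have hk0 : (0 : ℝ) < k := by exact_mod_cast hk
  have ht0 : (0 : ℝ) < ((n / 2 : ℕ) : ℝ) + 2 := by positivity
  refine ⟨fun _ => hB.mono (mul_le_mul_of_nonneg_right ?_ hW),
    fun _ => hB.mono (mul_le_mul_of_nonneg_right ?_ hW)⟩
  · rw [show ((k : ℝ) + 1) / (2 * k) = 1 / 2 + 1 / (2 * k) by field_simp]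
    gcongr
  · rw [show ((k : ℝ) + 2) / (2 * (k + 1)) = 1 / 2 + 1 / (2 * (k + 1)) by field_simp; ring]
    have hk1 : ((n / 2 : ℕ) : ℝ) + 2 ≤ k + 1 := by linarith
    gcongr 1 / 2 + 1 / (2 * ?_)

end WeightedBisection

theorem mainTheorem3 :
    WeightedBisection.AlmostAllGraphs (fun (n : ℕ) (G : SimpleGraph (Fin n)) =>
      ∀ w : G.edgeSet → ℝ, (∀ e, 0 ≤ w e) →
        WeightedBisection.SatisfiesBisectionBound G w) := by
  refine WeightedBisection.almostAllGraphs_of_failRatio ?_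
  have h := WeightedBisection.tendsto_failRatio_hasNonEdgeMatching.add
    WeightedBisection.tendsto_failRatio_hasLargeMaxDegree
  rw [add_zero] at h
  refine squeeze_zero' (Eventually.of_forall fun n => WeightedBisection.failRatio_nonneg _ n) ?_ h
  filter_upwards [eventually_ge_atTop 8] with n hn
  exact WeightedBisection.failRatio_le_add fun G hM hD w hw =>
    WeightedBisection.satisfiesBisectionBound_of_matching hn hM hD w hw
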